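/- Let $N\ge 2$, let $\Omega\subset\mathbb R^N$ be a bounded open set, $T>0$, $r>0$, $Y=(0,1)^N$ and $S=(0,1)$. Let $Y^H\subset Y$ be compact and put $Y^*=Y\setminus Y^H$. (The boundaries of $\Omega$ and $Y^H$ may be smooth, but no regularity is required.) For $\varepsilon>0$ let $\Omega_\varepsilon$ be the open set obtained from $\Omega$ by removing the holes $\varepsilon(Y^H+k)$ for all $k\in\mathbb Z^N$ whose cell $\varepsilon(Y+k)$ does not meet $\partial\Omega$. A sequence $\{w_\varepsilon\}$ in $L^2(\Omega\times(0,T))$, with $\varepsilon$ running through a sequence of positive numbers tending to $0$, is said to $(2,2)$-scale converge to $w_0\in L^2(\Omega\times(0,T)\times Y\times S)$ if $$\lim_{\varepsilon\to0}\int_0^T\!\!\int_\Omega w_\varepsilon(x,t)\,v\Big(x,t,\frac{x}{\varepsilon},\frac{t}{\varepsilon^r}\Big)dx\,dt=\int_0^T\!\!\int_\Omega\int_0^1\!\!\int_Y w_0(x,t,y,s)\,v(x,t,y,s)\,dy\,ds\,dx\,dt$$ for all $v\in L^2(\Omega\times(0,T);C_\sharp(Y\times S))$, where $C_\sharp(Y\times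 S)$ is the space of continuous $Y\times S$-periodic functions on $\mathbb R^N\times\mathbb R$ with the supremum norm. Let $\{u_\varepsilon\}$ be bounded in $L^2(0,T;H^1(\Omega_\varepsilon))$ (that is, $u_\varepsilon\in L^2(0,T;H^1(\Omega_\varepsilon))$ with norms bounded independently of $\varepsilon$), let $\widetilde{u_\varepsilon}$ be the extension of $u_\varepsilon$ by zero from $\Omega_\varepsilon$ to $\Omega$, and assume that $\widetilde{u_\varepsilon}$ $(2,2)$-scale converges to $u(x,t)\chi_{Y^*}(y)$ for some $u\in L^2(\Omega\times(0,T))$. Then $u\in L^2(0,T;H^1(\Omega))$; that is, for almost every $t\in(0,T)$ the function $u(\cdot,t)$ has a weak gradient $\nabla u(\cdot,t)$ in $L^2(\Omega)^N$, and $\nabla u\in L^2(\Omega\times(0,T))^N$. -/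

import Mathlib

open MeasureTheory Set Filter Topology
open scoped ContDiff BoundedContinuousFunction ENNReal

namespace Perforated

/-- The vector of `ℝ^N` with integer coordinates `k`. -/
noncomputable def latticeVec {N : ℕ} (k : Fin N → ℤ) : EuclideanSpace ℝ (Fin N) :=
  WithLp.toLp 2 (fun i => (k i : ℝ))

/-- The open unit cube `Y = (0,1)^N`. -/
def unitCell (N : ℕ) : Set (EuclideanSpace ℝ (Fin N)) :=
  {y | ∀ i, y i ∈ Ioo (0 : ℝ) 1}

/-- The copy `ε (A + k)` of a subset `A` of the unit cube, of size `ε`, in the cell of index `k`. -/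
noncomputable def cellCopy {N : ℕ} (ε : ℝ) (k : Fin N → ℤ) (A : Set (EuclideanSpace ℝ (Fin N))) :
    Set (EuclideanSpace ℝ (Fin N)) :=
  (fun y => ε • (y + latticeVec k)) '' A

/-- The perforated domain `Ω_ε`: from `Ω` one removes the holes `ε (H + k)` of all those cells
`ε (Y + k)` which do not meet the boundary of `Ω`. The cells that meet the boundary are not
perforated, and the interfaces between neighbouring cells belong to the domain. -/
noncomputable def perforatedDomain {N : ℕ} (Ω H : Set (EuclideanSpace ℝ (Fin N))) (ε : ℝ) :
    Set (EuclideanSpace ℝ (Fin N)) :=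
  Ω \ ⋃ k ∈ {k : Fin N → ℤ | Disjoint (cellCopy ε k (unitCell N)) (frontier Ω)}, cellCopy ε k H

/-- `f ∈ H¹(D)` with weak gradient `F`: both are in `L²(D)`, and
`∫_D f ∂_i φ = - ∫_D F_i φ` for all test functions `φ ∈ C_c^∞(D)` and all `i`. -/
structure HasH1Gradient {N : ℕ} (D : Set (EuclideanSpace ℝ (Fin N)))
    (f : EuclideanSpace ℝ (Fin N) → ℝ)
    (F : EuclideanSpace ℝ (Fin N) → EuclideanSpace ℝ (Fin N)) : Prop where
  memLp_fun : MemLp f 2 (volume.restrict D)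
  memLp_grad : MemLp F 2 (volume.restrict D)
  integral_eq : ∀ φ : EuclideanSpace ℝ (Fin N) → ℝ,
    ContDiff ℝ ∞ φ → HasCompactSupport φ → tsupport φ ⊆ D → ∀ i : Fin N,
      ∫ x in D, f x * fderiv ℝ φ x (EuclideanSpace.single i (1 : ℝ)) = - ∫ x in D, F x i * φ x

/-- The squared norm `‖f‖²_{H¹(D)} = ∫_D |f|² + |F|²`, where `F` is the weak gradient of `f`. -/
noncomputable def h1NormSq {N : ℕ} (D : Set (EuclideanSpace ℝ (Fin N)))
    (f : EuclideanSpace ℝ (Fin N) → ℝ)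
    (F : EuclideanSpace ℝ (Fin N) → EuclideanSpace ℝ (Fin N)) : ℝ≥0∞ :=
  ∫⁻ x in D, (‖f x‖ₑ ^ 2 + ‖F x‖ₑ ^ 2)

/-- The squared norm of `L²(0,T;H¹(D))`, the integral of `‖u(·,t)‖²_{H¹(D)}` over `(0,T)`;
`g` is the spatial weak gradient of `u`. -/
noncomputable def l2H1NormSq {N : ℕ} (D : Set (EuclideanSpace ℝ (Fin N))) (T : ℝ)
    (u : EuclideanSpace ℝ (Fin N) × ℝ → ℝ)
    (g : EuclideanSpace ℝ (Fin N) × ℝ → EuclideanSpace ℝ (Fin N)) : ℝ≥0∞ :=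
  ∫⁻ t in Ioo 0 T, h1NormSq D (fun x => u (x, t)) (fun x => g (x, t))

/-- `u ∈ L²(0,T;H¹(D))` with spatial weak gradient `g`: for almost every `t` the slice `u(·,t)` is
in `H¹(D)` with weak gradient `g(·,t)`, and `∫_0^T ‖u(·,t)‖²_{H¹(D)} dt < ∞`. The elements of the
Bochner space are represented by jointly measurable functions of `(x,t)`. -/
structure HasL2H1Gradient {N : ℕ} (D : Set (EuclideanSpace ℝ (Fin N))) (T : ℝ)
    (u : EuclideanSpace ℝ (Fin N) × ℝ → ℝ)
    (g : EuclideanSpace ℝ (Fin N) × ℝ → EuclideanSpace ℝ (Fin N)) : Prop where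
  aesm_fun : AEStronglyMeasurable u (volume.restrict (D ×ˢ Ioo 0 T))
  aesm_grad : AEStronglyMeasurable g (volume.restrict (D ×ˢ Ioo 0 T))
  slice : ∀ᵐ t ∂(volume.restrict (Ioo 0 T)),
    HasH1Gradient D (fun x => u (x, t)) (fun x => g (x, t))
  norm_lt_top : l2H1NormSq D T u g < ⊤

/-- `u ∈ L²(0,T;H¹(D))`. -/
def MemL2H1 {N : ℕ} (D : Set (EuclideanSpace ℝ (Fin N))) (T : ℝ)
    (u : EuclideanSpace ℝ (Fin N) × ℝ → ℝ) : Prop :=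
  ∃ g : EuclideanSpace ℝ (Fin N) × ℝ → EuclideanSpace ℝ (Fin N), HasL2H1Gradient D T u g

/-- The sequence `u n ∈ L²(0,T;H¹(D n))` is bounded, the norms being bounded by a constant that
does not depend on `n`. -/
def BoundedInL2H1 {N : ℕ} (D : ℕ → Set (EuclideanSpace ℝ (Fin N))) (T : ℝ)
    (u : ℕ → EuclideanSpace ℝ (Fin N) × ℝ → ℝ) : Prop :=
  ∃ C : ℝ≥0∞, C < ⊤ ∧ ∀ n, ∃ g : EuclideanSpace ℝ (Fin N) × ℝ → EuclideanSpace ℝ (Fin N),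
    HasL2H1Gradient (D n) T (u n) g ∧ l2H1NormSq (D n) T (u n) g ≤ C

/-- The space `C_♯(Y × S)`, `S = (0,1)`, of continuous functions of `(y,s) ∈ ℝ^N × ℝ` that are
`Y × S`-periodic, with the supremum norm. -/
noncomputable def periodicCont (N : ℕ) :
    Submodule ℝ ((EuclideanSpace ℝ (Fin N) × ℝ) →ᵇ ℝ) where
  carrier := {f | ∀ (k : Fin N → ℤ) (m : ℤ) (y : EuclideanSpace ℝ (Fin N)) (s : ℝ),
    f (y + latticeVec k, s + (m : ℝ)) = f (y, s)}
  add_mem' := by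
    intro f g hf hg k m y s
    simp only [BoundedContinuousFunction.coe_add, Pi.add_apply, hf k m y s, hg k m y s]
  zero_mem' := by
    intro k m y s
    rfl
  smul_mem' := by
    intro c f hf k m y s
    simp only [BoundedContinuousFunction.coe_smul, hf k m y s]

/-- The sequence `w n ∈ L²(Ω × (0,T))` `(2,2)`-scale converges to
`w₀ ∈ L²(Ω × (0,T) × Y × S)` with respect to the spatial scales `ε n` and the temporal scales
`ε' n`: for all `v ∈ L²(Ω × (0,T); C_♯(Y × S))` the integrals of
`w n (x,t) v(x,t,x/ε,t/ε')` tend to the integral of `w₀ v` over `Ω × (0,T) × Y × S`. -/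
structure TwoTwoScaleConverges {N : ℕ} (Ω : Set (EuclideanSpace ℝ (Fin N))) (T : ℝ)
    (ε ε' : ℕ → ℝ) (w : ℕ → EuclideanSpace ℝ (Fin N) × ℝ → ℝ)
    (w₀ : (EuclideanSpace ℝ (Fin N) × ℝ) × (EuclideanSpace ℝ (Fin N) × ℝ) → ℝ) : Prop where
  memLp_seq : ∀ n, MemLp (w n) 2 (volume.restrict (Ω ×ˢ Ioo 0 T))
  memLp_lim : MemLp w₀ 2
    (volume.restrict ((Ω ×ˢ Ioo (0 : ℝ) T) ×ˢ (unitCell N ×ˢ Ioo (0 : ℝ) 1)))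
  tendsto : ∀ v : EuclideanSpace ℝ (Fin N) × ℝ → periodicCont N,
    MemLp v 2 (volume.restrict (Ω ×ˢ Ioo 0 T)) →
      Tendsto
        (fun n => ∫ z in Ω ×ˢ Ioo 0 T, w n z *
          (v z : (EuclideanSpace ℝ (Fin N) × ℝ) →ᵇ ℝ) ((ε n)⁻¹ • z.1, z.2 / ε' n))
        atTop
        (𝓝 (∫ z in Ω ×ˢ Ioo 0 T, ∫ q in unitCell N ×ˢ Ioo (0 : ℝ) 1, w₀ (z, q) *
          (v z : (EuclideanSpace ℝ (Fin N) × ℝ) →ᵇ ℝ) q))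

end Perforated

/-!
The weak gradient of `u` is obtained by duality, with test functions that live off the holes.

Fix a direction `i`. Since `N ≥ 2`, there is a second direction `j ≠ i`. The holes being compact in
the open cell, there is `a < 1` with `cos (2π y_j) < a` on `H`, and `ρ = channelWeight a` is a
smooth `1`-periodic function, `0 ≤ ρ ≤ 1`, such that `ρ (y_j)` vanishes on all translates of `H`
but has a positive mean `c` over the cell. It is supported in channels around the cell faces
orthogonal to the `j`-th axis, and `∂_i` does not see it. In other words, `ρ (y_j) e_i` is a
divergence-free field that vanishes on the holes and has the mean `c e_i`.

For a test function `φ` on `Ω` the product `φ(x) ρ(x_j / ε)` is therefore a test function on `Ω_ε`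
(`tsupport_mul_channelWeight_subset`), with `i`-th derivative `∂_i φ(x) ρ(x_j / ε)`
(`fderiv_mul_channelWeight`). Integrating by parts on the slices and then over a measurable set `S`
of times gives
`∫_Ω ∫_S u_ε ∂_i φ ρ(x_j / ε) = - ∫_Ω ∫_S w_ε φ`, where `w_ε = ∂_i u_ε ρ(x_j / ε)`, extended by
zero, is bounded in `L²(Ω × (0,T))`. On the left the two-scale convergence applies and yields
`c ∫_Ω ∫_S u ∂_i φ`, because `ρ` vanishes on `H`; on the right `w_ε` converges weakly to some `G`
along an ultrafilter (`exists_weak_limit`). So `c⁻¹ G` is the `i`-th partial derivative of `u`, in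
the sense of integrals over `Ω × S` (`exists_partial_deriv`). As `S` is arbitrary and the
pairs `(φ, ∂_i φ)` form a separable subset of `L²(Ω) × L²(Ω)`, the integration by parts holds on
almost every time slice for all `φ` at once (`ae_slice_integral_eq`).
-/

namespace Perforated

/-! ### Weak compactness in `L²` -/

lemma memLp_mul_bounded {α : Type*} [MeasurableSpace α] {μ : Measure α} {f g : α → ℝ} {c : ℝ}
    (hf : MemLp f 2 μ) (hg : AEStronglyMeasurable g μ) (hc : ∀ x, |g x| ≤ c) :
    MemLp (fun x => f x * g x) 2 μ := by
  refine MemLp.of_le_mul (c := c) hf (hf.1.mul hg) (Eventually.of_forall fun x => ?_)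
  rw [norm_mul, mul_comm, Real.norm_eq_abs (g x)]
  exact mul_le_mul_of_nonneg_right (hc x) (norm_nonneg _)

lemma inner_toLp_eq_integral_mul {α : Type*} [MeasurableSpace α] {μ : Measure α} {f g : α → ℝ}
    (hf : MemLp f 2 μ) (hg : MemLp g 2 μ) :
    inner ℝ (hf.toLp f) (hg.toLp g) = ∫ x, f x * g x ∂μ := by
  rw [L2.inner_def]
  refine integral_congr_ae ?_
  filter_upwards [hf.coeFn_toLp, hg.coeFn_toLp] with x hx hy
  rw [hx, hy]
  simp [mul_comm]

/-- A bounded sequence in `L²` converges weakly along some filter finer than `atTop` (an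
ultrafilter), by the Banach–Alaoglu theorem. Convergence along a filter serves as well as
convergence of a subsequence, and needs no separability. -/
lemma exists_weak_limit {α : Type*} [MeasurableSpace α] {μ : Measure α} {f : ℕ → α → ℝ}
    (hf : ∀ n, MemLp (f n) 2 μ) {M : ℝ≥0∞} (hM : M ≠ ⊤) (hb : ∀ n, eLpNorm (f n) 2 μ ≤ M) :
    ∃ l : Filter ℕ, l.NeBot ∧ l ≤ atTop ∧ ∃ G : α → ℝ, MemLp G 2 μ ∧
      ∀ v : α → ℝ, MemLp v 2 μ →
        Tendsto (fun n => ∫ x, f n x * v x ∂μ) l (𝓝 (∫ x, G x * v x ∂μ)) := by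
  let F : ℕ → WeakDual ℝ (Lp ℝ 2 μ) := fun n =>
    StrongDual.toWeakDual (InnerProductSpace.toDual ℝ (Lp ℝ 2 μ) ((hf n).toLp (f n)))
  have hF : ∀ n, F n ∈ WeakDual.toStrongDual ⁻¹'
      Metric.closedBall (0 : StrongDual ℝ (Lp ℝ 2 μ)) M.toReal := by
    intro n
    change dist (InnerProductSpace.toDual ℝ (Lp ℝ 2 μ) ((hf n).toLp (f n))) 0 ≤ _
    rw [dist_zero_right, LinearIsometryEquiv.norm_map, Lp.norm_toLp]
    exact ENNReal.toReal_mono hM (hb n)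
  obtain ⟨L, -, hL⟩ := (WeakDual.isCompact_closedBall (𝕜 := ℝ)
    (0 : StrongDual ℝ (Lp ℝ 2 μ)) M.toReal).ultrafilter_le_nhds ((hyperfilter ℕ).map F)
    (by
      rw [le_principal_iff, Ultrafilter.mem_coe, Ultrafilter.mem_map]
      exact Eventually.of_forall hF)
  let G : Lp ℝ 2 μ := (InnerProductSpace.toDual ℝ (Lp ℝ 2 μ)).symm (WeakDual.toStrongDual L)
  refine ⟨hyperfilter ℕ, inferInstance, Nat.hyperfilter_le_atTop, G, Lp.memLp G, fun v hv => ?_⟩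
  have h := ((WeakDual.eval_continuous (𝕜 := ℝ) (hv.toLp v)).tendsto L).comp
    (show Tendsto F (hyperfilter ℕ) (𝓝 L) from hL)
  have hGv : L (hv.toLp v) = ∫ x, G x * v x ∂μ := by
    rw [← inner_toLp_eq_integral_mul (Lp.memLp G) hv, Lp.toLp_coeFn]
    exact (InnerProductSpace.toDual_symm_apply (𝕜 := ℝ)).symm
  rw [hGv] at h
  refine h.congr fun n => ?_
  rw [← inner_toLp_eq_integral_mul (hf n) hv]
  rfl

/-! ### The channel weight -/

/-- A smooth `1`-periodic function with values in `[0,1]`, positive exactly where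
`cos (2πs) > a`. For `a < 1` close to `1` it is concentrated near the integers. -/
noncomputable def channelWeight (a s : ℝ) : ℝ :=
  Real.smoothTransition (Real.cos (2 * Real.pi * s) - a)

lemma contDiff_channelWeight (a : ℝ) : ContDiff ℝ ∞ (channelWeight a) :=
  Real.smoothTransition.contDiff.comp (by fun_prop)

lemma channelWeight_nonneg (a s : ℝ) : 0 ≤ channelWeight a s :=
  Real.smoothTransition.nonneg _

lemma abs_channelWeight_le (a s : ℝ) : |channelWeight a s| ≤ 1 := by
  rw [abs_of_nonneg (channelWeight_nonneg a s)]
  exact Real.smoothTransition.le_one _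

lemma channelWeight_eq_zero {a s : ℝ} (h : Real.cos (2 * Real.pi * s) ≤ a) :
    channelWeight a s = 0 :=
  Real.smoothTransition.zero_of_nonpos (by linarith)

lemma cos_two_pi_mul_add_int (s : ℝ) (k : ℤ) :
    Real.cos (2 * Real.pi * (s + k)) = Real.cos (2 * Real.pi * s) := by
  rw [show 2 * Real.pi * (s + k) = 2 * Real.pi * s + k * (2 * Real.pi) by ring,
    Real.cos_add_int_mul_two_pi]

/-- The channel weight in the `j`-th variable as a function in `C_♯(Y × S)`. -/
noncomputable def channelCont {N : ℕ} (a : ℝ) (j : Fin N) : periodicCont N :=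
  ⟨BoundedContinuousFunction.ofNormedAddCommGroup (fun q => channelWeight a (q.1 j))
    ((contDiff_channelWeight a).continuous.comp (by fun_prop)) 1
    (fun q => abs_channelWeight_le a _), by
      intro k m y s
      simp [channelWeight, latticeVec, cos_two_pi_mul_add_int]⟩

lemma norm_smul_channelCont_le {N : ℕ} (d a : ℝ) (j : Fin N) : ‖d • channelCont a j‖ ≤ ‖d‖ := by
  refine (BoundedContinuousFunction.norm_le (norm_nonneg d)).2 fun q => ?_
  change ‖d * channelWeight a (q.1 j)‖ ≤ ‖d‖
  rw [norm_mul]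
  exact mul_le_of_le_one_right (norm_nonneg d) (abs_channelWeight_le a _)

lemma memLp_smul_channelCont {N : ℕ} {α : Type*} [MeasurableSpace α] {μ : Measure α} {d : α → ℝ}
    (hd : MemLp d 2 μ) (a : ℝ) (j : Fin N) : MemLp (fun z => d z • channelCont a j) 2 μ :=
  MemLp.of_le (E := periodicCont N) hd (hd.1.smul_const (channelCont a j))
    (Eventually.of_forall fun z => norm_smul_channelCont_le (d z) a j)

/-- A compact subset of the open unit cube stays away from the faces of the cube. -/
lemma exists_cos_lt {N : ℕ} {H : Set (EuclideanSpace ℝ (Fin N))} (hH : IsCompact H)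
    (hHY : H ⊆ unitCell N) (j : Fin N) :
    ∃ a < 1, ∀ y ∈ H, Real.cos (2 * Real.pi * y j) < a := by
  rcases H.eq_empty_or_nonempty with rfl | hne
  · exact ⟨0, one_pos, by simp⟩
  obtain ⟨y, hy, hmax⟩ := hH.exists_isMaxOn hne
    (f := fun y : EuclideanSpace ℝ (Fin N) => Real.cos (2 * Real.pi * y j))
    (Continuous.continuousOn (by fun_prop))
  have hlt : Real.cos (2 * Real.pi * y j) < 1 := by
    refine lt_of_le_of_ne (Real.cos_le_one _) fun h => ?_
    rw [Real.cos_eq_one_iff] at h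
    obtain ⟨n, hn⟩ := h
    have h2 : (n : ℝ) = y j := by
      have := Real.pi_pos
      have h3 : (n : ℝ) * (2 * Real.pi) = y j * (2 * Real.pi) := by linarith
      exact mul_right_cancel₀ (by positivity) h3
    have h3 := hHY hy j
    rw [← h2] at h3
    have h4 : 0 < n := by exact_mod_cast h3.1
    have h5 : n < 1 := by exact_mod_cast h3.2
    omega
  obtain ⟨a, ha, ha1⟩ := exists_between hlt
  exact ⟨a, ha1, fun z hz => (hmax hz).trans_lt ha⟩

lemma isOpen_unitCell (N : ℕ) : IsOpen (unitCell N) := by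
  simp only [unitCell, ofPred_forall]
  exact isOpen_iInter_of_finite fun i => isOpen_Ioo.preimage (by fun_prop)

lemma isBounded_unitCell (N : ℕ) : Bornology.IsBounded (unitCell N) := by
  have h : unitCell N ⊆ (EuclideanSpace.equiv (Fin N) ℝ) ⁻¹'
      (Set.pi univ fun _ => Icc (0 : ℝ) 1) := by
    intro y hy i _
    exact Ioo_subset_Icc_self (hy i)
  refine (IsCompact.isBounded ?_).subset h
  exact (EuclideanSpace.equiv (Fin N) ℝ).toHomeomorph.isClosedEmbedding.isCompact_preimage
    (isCompact_univ_pi fun _ => isCompact_Icc)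

lemma integral_channelWeight_pos {N : ℕ} {a : ℝ} (ha : a < 1) (j : Fin N) :
    0 < ∫ q in unitCell N ×ˢ Ioo (0 : ℝ) 1, channelWeight a (q.1 j) := by
  have hfin : volume (unitCell N ×ˢ Ioo (0 : ℝ) 1) < ⊤ :=
    ((isBounded_unitCell N).prod (Metric.isBounded_Ioo 0 1)).measure_lt_top
  have hcont : Continuous fun q : EuclideanSpace ℝ (Fin N) × ℝ => channelWeight a (q.1 j) :=
    (contDiff_channelWeight a).continuous.comp (by fun_prop)
  have hopen : IsOpen (unitCell N ×ˢ Ioo (0 : ℝ) 1) := (isOpen_unitCell N).prod isOpen_Ioo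
  rw [setIntegral_pos_iff_support_of_nonneg_ae
    (Eventually.of_forall fun q => channelWeight_nonneg a _)
    (Measure.integrableOn_of_bounded (M := 1) hfin.ne hcont.aestronglyMeasurable
      (Eventually.of_forall fun q => abs_channelWeight_le a _))]
  refine (hcont.isOpen_support.inter hopen).measure_pos _ ?_
  -- near the corner `0` of the cube the cosine is close to `1`
  have hev : ∀ᶠ s in 𝓝[>] (0 : ℝ), a < Real.cos (2 * Real.pi * s) ∧ s ∈ Ioo (0 : ℝ) 1 := by
    refine Eventually.and ?_ (Ioo_mem_nhdsGT one_pos)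
    refine (Continuous.tendsto (f := fun s => Real.cos (2 * Real.pi * s)) (by fun_prop) 0
      |>.eventually_const_lt (by simpa using ha)).filter_mono nhdsWithin_le_nhds
  obtain ⟨s, hs, hs01⟩ := hev.exists
  refine ⟨(WithLp.toLp 2 fun _ => s, s), ?_, fun i => hs01, hs01⟩
  exact (Real.smoothTransition.pos_of_pos (by simpa using hs)).ne'

/-! ### Test functions supported off the holes -/

lemma measurableSet_perforatedDomain {N : ℕ} {Ω H : Set (EuclideanSpace ℝ (Fin N))}
    (hΩ : IsOpen Ω) (hH : IsCompact H) (ε : ℝ) : MeasurableSet (perforatedDomain Ω H ε) := by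
  refine hΩ.measurableSet.diff (MeasurableSet.biUnion (to_countable _) fun k _ => ?_)
  exact (hH.image (by fun_prop)).measurableSet

section TestFunction

variable {N : ℕ} {Ω H : Set (EuclideanSpace ℝ (Fin N))} {φ : EuclideanSpace ℝ (Fin N) → ℝ}

lemma contDiff_channelWeight_comp (a ε : ℝ) (j : Fin N) :
    ContDiff ℝ ∞ fun x : EuclideanSpace ℝ (Fin N) => channelWeight a (ε⁻¹ * x j) :=
  (contDiff_channelWeight a).comp (by fun_prop)

/-- Since the weight does not depend on the `i`-th variable, it passes through `∂_i`. -/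
lemma fderiv_mul_channelWeight (hφ : ContDiff ℝ ∞ φ) (a ε : ℝ) {i j : Fin N} (hij : j ≠ i)
    (x : EuclideanSpace ℝ (Fin N)) :
    fderiv ℝ (fun x => φ x * channelWeight a (ε⁻¹ * x j)) x (EuclideanSpace.single i 1) =
      fderiv ℝ φ x (EuclideanSpace.single i 1) * channelWeight a (ε⁻¹ * x j) := by
  have h1 : DifferentiableAt ℝ φ x := hφ.differentiable (by simp) x
  have h2 : DifferentiableAt ℝ
      (fun x : EuclideanSpace ℝ (Fin N) => channelWeight a (ε⁻¹ * x j)) x :=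
    (contDiff_channelWeight_comp a ε j).differentiable (by simp) x
  have h3 : fderiv ℝ (fun x : EuclideanSpace ℝ (Fin N) => channelWeight a (ε⁻¹ * x j)) x
      (EuclideanSpace.single i 1) = 0 := by
    rw [← h2.lineDeriv_eq_fderiv, lineDeriv]
    have : (fun t : ℝ => channelWeight a
        (ε⁻¹ * (x + t • EuclideanSpace.single i (1 : ℝ)) j)) =
        fun _ => channelWeight a (ε⁻¹ * x j) := by
      funext t
      simp [hij]
    rw [this, deriv_const]
  rw [fderiv_fun_mul h1 h2]
  simp [h3, mul_comm]

lemma tsupport_mul_channelWeight_subset (hsupp : tsupport φ ⊆ Ω) {a ε : ℝ} (hε : 0 < ε)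
    {j : Fin N} (ha : ∀ y ∈ H, Real.cos (2 * Real.pi * y j) < a) :
    tsupport (fun x => φ x * channelWeight a (ε⁻¹ * x j)) ⊆ perforatedDomain Ω H ε := by
  intro x hx
  refine ⟨hsupp (closure_mono (fun y hy => left_ne_zero_of_mul hy) hx), ?_⟩
  have hcos : a ≤ Real.cos (2 * Real.pi * (ε⁻¹ * x j)) := by
    have hcl : IsClosed {x : EuclideanSpace ℝ (Fin N) |
        a ≤ Real.cos (2 * Real.pi * (ε⁻¹ * x j))} :=
      isClosed_le continuous_const (by fun_prop)
    refine closure_minimal (fun y hy => ?_) hcl hx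
    by_contra hlt
    exact right_ne_zero_of_mul hy (channelWeight_eq_zero (not_le.1 hlt).le)
  simp only [mem_iUnion, not_exists]
  rintro k - ⟨y, hy, rfl⟩
  have hval : ε⁻¹ * (ε • (y + latticeVec k)) j = y j + k j := by
    simp only [latticeVec, PiLp.smul_apply, PiLp.add_apply, smul_eq_mul]
    rw [inv_mul_cancel_left₀ hε.ne']
  rw [hval, cos_two_pi_mul_add_int] at hcos
  exact (ha y hy).not_ge hcos

end TestFunction
/-! ### Slices in time -/

section Slices

variable {N : ℕ} {D : Set (EuclideanSpace ℝ (Fin N))} {T : ℝ}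

lemma volume_restrict_prod (A : Set (EuclideanSpace ℝ (Fin N))) (I : Set ℝ) :
    (volume : Measure (EuclideanSpace ℝ (Fin N) × ℝ)).restrict (A ×ˢ I) =
      (volume.restrict A).prod (volume.restrict I) := by
  rw [Measure.prod_restrict, Measure.volume_eq_prod]

lemma isFiniteMeasure_restrict_prod_Ioo (hD : volume D ≠ ⊤) :
    IsFiniteMeasure (volume.restrict (D ×ˢ Ioo (0 : ℝ) T)) := by
  refine ⟨?_⟩
  rw [Measure.restrict_apply_univ, Measure.volume_eq_prod, Measure.prod_prod]
  exact ENNReal.mul_lt_top hD.lt_top measure_Ioo_lt_top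

lemma lintegral_prod_eq_l2H1NormSq {u : EuclideanSpace ℝ (Fin N) × ℝ → ℝ}
    {g : EuclideanSpace ℝ (Fin N) × ℝ → EuclideanSpace ℝ (Fin N)}
    (hu : AEStronglyMeasurable u (volume.restrict (D ×ˢ Ioo 0 T)))
    (hg : AEStronglyMeasurable g (volume.restrict (D ×ˢ Ioo 0 T))) :
    ∫⁻ z in D ×ˢ Ioo 0 T, (‖u z‖ₑ ^ 2 + ‖g z‖ₑ ^ 2) = l2H1NormSq D T u g := by
  rw [volume_restrict_prod] at hu hg ⊢
  exact lintegral_prod_symm _ ((hu.enorm.pow_const 2).add (hg.enorm.pow_const 2))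

lemma eLpNorm_two_sq {α F : Type*} [MeasurableSpace α] [NormedAddCommGroup F] {μ : Measure α}
    (f : α → F) : eLpNorm f 2 μ ^ 2 = ∫⁻ x, ‖f x‖ₑ ^ 2 ∂μ := by
  have h := eLpNorm_nnreal_pow_eq_lintegral (μ := μ) (f := f) (p := 2) (by norm_num)
  simpa only [NNReal.coe_ofNat, ENNReal.rpow_ofNat, ENNReal.coe_ofNat] using h

lemma HasL2H1Gradient.eLpNorm_fun_sq_le {u : EuclideanSpace ℝ (Fin N) × ℝ → ℝ}
    {g : EuclideanSpace ℝ (Fin N) × ℝ → EuclideanSpace ℝ (Fin N)}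
    (h : HasL2H1Gradient D T u g) :
    eLpNorm u 2 (volume.restrict (D ×ˢ Ioo 0 T)) ^ 2 ≤ l2H1NormSq D T u g := by
  rw [eLpNorm_two_sq, ← lintegral_prod_eq_l2H1NormSq h.aesm_fun h.aesm_grad]
  exact lintegral_mono fun z => le_self_add

lemma HasL2H1Gradient.eLpNorm_grad_sq_le {u : EuclideanSpace ℝ (Fin N) × ℝ → ℝ}
    {g : EuclideanSpace ℝ (Fin N) × ℝ → EuclideanSpace ℝ (Fin N)}
    (h : HasL2H1Gradient D T u g) :
    eLpNorm g 2 (volume.restrict (D ×ˢ Ioo 0 T)) ^ 2 ≤ l2H1NormSq D T u g := by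
  rw [eLpNorm_two_sq, ← lintegral_prod_eq_l2H1NormSq h.aesm_fun h.aesm_grad]
  exact lintegral_mono fun z => le_add_self

lemma HasL2H1Gradient.memLp_fun {u : EuclideanSpace ℝ (Fin N) × ℝ → ℝ}
    {g : EuclideanSpace ℝ (Fin N) × ℝ → EuclideanSpace ℝ (Fin N)}
    (h : HasL2H1Gradient D T u g) : MemLp u 2 (volume.restrict (D ×ˢ Ioo 0 T)) :=
  ⟨h.aesm_fun, (ENNReal.pow_lt_top_iff.1 (h.eLpNorm_fun_sq_le.trans_lt h.norm_lt_top)).resolve_right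
    two_ne_zero⟩

lemma HasL2H1Gradient.memLp_grad {u : EuclideanSpace ℝ (Fin N) × ℝ → ℝ}
    {g : EuclideanSpace ℝ (Fin N) × ℝ → EuclideanSpace ℝ (Fin N)}
    (h : HasL2H1Gradient D T u g) : MemLp g 2 (volume.restrict (D ×ˢ Ioo 0 T)) :=
  ⟨h.aesm_grad,
    (ENNReal.pow_lt_top_iff.1 (h.eLpNorm_grad_sq_le.trans_lt h.norm_lt_top)).resolve_right
      two_ne_zero⟩

lemma ae_memLp_two_slice {F : Type*} [NormedAddCommGroup F]
    {f : EuclideanSpace ℝ (Fin N) × ℝ → F} {I : Set ℝ}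
    (hf : MemLp f 2 (volume.restrict (D ×ˢ I))) :
    ∀ᵐ t ∂(volume.restrict I), MemLp (fun x => f (x, t)) 2 (volume.restrict D) := by
  rw [volume_restrict_prod] at hf
  filter_upwards [hf.1.prodMk_right,
    ((memLp_two_iff_integrable_sq_norm hf.1).1 hf).prod_left_ae] with t h1 h2
  exact (memLp_two_iff_integrable_sq_norm h1).2 h2

/-- Fubini's theorem for the product of an `L²` function of `(x,t)`, a bounded function of `x` and
the indicator of a set of times. -/
lemma integral_mul_indicator_eq (hD : volume D ≠ ⊤) {f : EuclideanSpace ℝ (Fin N) × ℝ → ℝ}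
    (hf : MemLp f 2 (volume.restrict (D ×ˢ Ioo 0 T))) {p : EuclideanSpace ℝ (Fin N) → ℝ}
    (hp : Continuous p) (hpc : HasCompactSupport p) {S : Set ℝ} (hS : MeasurableSet S) :
    ∫ z in D ×ˢ Ioo 0 T, f z * (p z.1 * S.indicator 1 z.2) =
      ∫ t in Ioo 0 T, (∫ x in D, f (x, t) * p x) * S.indicator 1 t := by
  have := isFiniteMeasure_restrict_prod_Ioo (T := T) hD
  obtain ⟨c, hc⟩ := hpc.exists_bound_of_continuous hp
  have hint : Integrable (fun z : EuclideanSpace ℝ (Fin N) × ℝ =>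
      f z * (p z.1 * S.indicator (1 : ℝ → ℝ) z.2)) (volume.restrict (D ×ˢ Ioo 0 T)) := by
    refine (memLp_mul_bounded (c := c) hf ?_ fun z => ?_).integrable one_le_two
    · exact ((hp.measurable.comp measurable_fst).mul
        ((measurable_one.indicator hS).comp measurable_snd)).aestronglyMeasurable
    · have h1 := hc z.1
      by_cases hz : z.2 ∈ S
      · simpa [hz] using h1
      · simpa [hz] using (norm_nonneg _).trans h1
  rw [volume_restrict_prod] at hint ⊢
  rw [integral_prod_symm _ hint]
  simp only [← mul_assoc, integral_mul_const]

lemma continuous_fderiv_single {φ : EuclideanSpace ℝ (Fin N) → ℝ} (hφ : ContDiff ℝ ∞ φ)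
    (i : Fin N) : Continuous fun x => fderiv ℝ φ x (EuclideanSpace.single i (1 : ℝ)) :=
  (hφ.continuous_fderiv (by simp)).clm_apply continuous_const

lemma hasCompactSupport_fderiv_single {φ : EuclideanSpace ℝ (Fin N) → ℝ}
    (hφ : HasCompactSupport φ) (i : Fin N) :
    HasCompactSupport fun x => fderiv ℝ φ x (EuclideanSpace.single i (1 : ℝ)) :=
  hφ.fderiv_apply (𝕜 := ℝ) _

/-- The integration by parts of the slices, integrated over a set of times. -/
lemma HasL2H1Gradient.integral_eq {u : EuclideanSpace ℝ (Fin N) × ℝ → ℝ}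
    {g : EuclideanSpace ℝ (Fin N) × ℝ → EuclideanSpace ℝ (Fin N)}
    (h : HasL2H1Gradient D T u g) (hD : volume D ≠ ⊤) {φ : EuclideanSpace ℝ (Fin N) → ℝ}
    (hφ : ContDiff ℝ ∞ φ) (hφc : HasCompactSupport φ) (hφD : tsupport φ ⊆ D) (i : Fin N)
    {S : Set ℝ} (hS : MeasurableSet S) :
    ∫ z in D ×ˢ Ioo 0 T, u z * (fderiv ℝ φ z.1 (EuclideanSpace.single i (1 : ℝ)) *
        S.indicator 1 z.2) =
      - ∫ z in D ×ˢ Ioo 0 T, g z i * (φ z.1 * S.indicator 1 z.2) := by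
  rw [integral_mul_indicator_eq hD h.memLp_fun (continuous_fderiv_single hφ i)
      (hasCompactSupport_fderiv_single hφc i) hS,
    integral_mul_indicator_eq hD (h.memLp_grad.eval_piLp i) hφ.continuous hφc hS,
    ← integral_neg]
  refine integral_congr_ae ?_
  filter_upwards [h.slice] with t ht
  rw [ht.integral_eq φ hφ hφc hφD i, neg_mul]

/-- If an integration by parts holds on `D × S` for all measurable sets `S` of times, then it holds
on almost every slice. The exceptional set of times is independent of the test function because
the pairs `(φ, ∂_i φ)` form a separable subset of `L²(D) × L²(D)`. -/
lemma ae_slice_integral_eq (hD : volume D ≠ ⊤) {u G : EuclideanSpace ℝ (Fin N) × ℝ → ℝ}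
    (hu : MemLp u 2 (volume.restrict (D ×ˢ Ioo 0 T)))
    (hG : MemLp G 2 (volume.restrict (D ×ˢ Ioo 0 T))) (i : Fin N)
    (h : ∀ φ : EuclideanSpace ℝ (Fin N) → ℝ,
      ContDiff ℝ ∞ φ → HasCompactSupport φ → tsupport φ ⊆ D → ∀ S : Set ℝ, MeasurableSet S →
        ∫ z in D ×ˢ Ioo 0 T, u z * (fderiv ℝ φ z.1 (EuclideanSpace.single i (1 : ℝ)) *
            S.indicator 1 z.2) =
          - ∫ z in D ×ˢ Ioo 0 T, G z * (φ z.1 * S.indicator 1 z.2)) :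
    ∀ᵐ t ∂(volume.restrict (Ioo 0 T)), ∀ φ : EuclideanSpace ℝ (Fin N) → ℝ,
      ContDiff ℝ ∞ φ → HasCompactSupport φ → tsupport φ ⊆ D →
        ∫ x in D, u (x, t) * fderiv ℝ φ x (EuclideanSpace.single i (1 : ℝ)) =
          - ∫ x in D, G (x, t) * φ x := by
  have := isFiniteMeasure_restrict_prod_Ioo (T := T) hD
  -- the integrals over the slices are integrable functions of time
  have hint : ∀ f : EuclideanSpace ℝ (Fin N) × ℝ → ℝ,
      MemLp f 2 (volume.restrict (D ×ˢ Ioo 0 T)) → ∀ p : EuclideanSpace ℝ (Fin N) → ℝ,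
        Continuous p → HasCompactSupport p →
          Integrable (fun t => ∫ x in D, f (x, t) * p x) (volume.restrict (Ioo 0 T)) := by
    intro f hf p hp hpc
    obtain ⟨c, hc⟩ := hpc.exists_bound_of_continuous hp
    have h1 := (memLp_mul_bounded (g := fun z => p z.1) hf
      (hp.comp continuous_fst).aestronglyMeasurable (fun z => hc z.1)).integrable one_le_two
    rw [volume_restrict_prod] at h1
    exact h1.integral_prod_right
  have hone : ∀ φ : EuclideanSpace ℝ (Fin N) → ℝ,
      ContDiff ℝ ∞ φ → HasCompactSupport φ → tsupport φ ⊆ D →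
        ∀ᵐ t ∂(volume.restrict (Ioo 0 T)),
          (∫ x in D, u (x, t) * fderiv ℝ φ x (EuclideanSpace.single i (1 : ℝ))) +
            ∫ x in D, G (x, t) * φ x = 0 := by
    intro φ hφ hφc hφD
    have hi1 := hint u hu _ (continuous_fderiv_single hφ i) (hasCompactSupport_fderiv_single hφc i)
    have hi2 := hint G hG φ hφ.continuous hφc
    refine (hi1.add hi2).ae_eq_zero_of_forall_setIntegral_eq_zero fun S hS _ => ?_
    have hmul : ∀ k : ℝ → ℝ, (fun t => k t * S.indicator 1 t) = S.indicator k := by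
      intro k
      funext t
      by_cases ht : t ∈ S <;> simp [ht]
    have hS' := h φ hφ hφc hφD S hS
    rw [integral_mul_indicator_eq hD hu (continuous_fderiv_single hφ i)
        (hasCompactSupport_fderiv_single hφc i) hS,
      integral_mul_indicator_eq hD hG hφ.continuous hφc hS, hmul, hmul,
      integral_indicator hS, integral_indicator hS] at hS'
    simp only [Pi.add_apply]
    rw [integral_add hi1.integrableOn hi2.integrableOn, hS', neg_add_cancel]
  have : Fact ((2 : ℝ≥0∞) ≠ ⊤) := ⟨ENNReal.ofNat_ne_top⟩
  have : SecondCountableTopology (Lp ℝ 2 (volume.restrict D)) := inferInstance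
  have hmem : ∀ p : EuclideanSpace ℝ (Fin N) → ℝ, Continuous p → HasCompactSupport p →
      MemLp p 2 (volume.restrict D) := fun p hp hpc => hp.memLp_of_hasCompactSupport hpc
  let Φ : {φ : EuclideanSpace ℝ (Fin N) → ℝ // ContDiff ℝ ∞ φ ∧ HasCompactSupport φ ∧
      tsupport φ ⊆ D} → Lp ℝ 2 (volume.restrict D) × Lp ℝ 2 (volume.restrict D) := fun φ =>
    ((hmem φ.1 φ.2.1.continuous φ.2.2.1).toLp φ.1,
      (hmem _ (continuous_fderiv_single φ.2.1 i)
        (hasCompactSupport_fderiv_single φ.2.2.1 i)).toLp _)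
  have hΦ : ∀ (φ) (f k : EuclideanSpace ℝ (Fin N) → ℝ),
      (∫ x in D, f x * (Φ φ).2 x) + ∫ x in D, k x * (Φ φ).1 x =
        (∫ x in D, f x * fderiv ℝ φ.1 x (EuclideanSpace.single i (1 : ℝ))) +
          ∫ x in D, k x * φ.1 x := by
    intro φ f k
    congr 1
    · refine integral_congr_ae ?_
      filter_upwards [(hmem _ (continuous_fderiv_single φ.2.1 i)
        (hasCompactSupport_fderiv_single φ.2.2.1 i)).coeFn_toLp] with x hx
      rw [← hx]
    · refine integral_congr_ae ?_
      filter_upwards [(hmem φ.1 φ.2.1.continuous φ.2.2.1).coeFn_toLp] with x hx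
      rw [← hx]
  obtain ⟨Q, hQr, hQc, hQd⟩ := (TopologicalSpace.IsSeparable.of_separableSpace
    (range Φ)).exists_countable_dense_subset
  have hQ : ∀ᵐ t ∂(volume.restrict (Ioo 0 T)), ∀ q ∈ Q,
      (∫ x in D, u (x, t) * q.2 x) + ∫ x in D, G (x, t) * q.1 x = 0 := by
    rw [ae_ball_iff hQc]
    intro q hq
    obtain ⟨φ, rfl⟩ := hQr hq
    filter_upwards [hone φ.1 φ.2.1 φ.2.2.1 φ.2.2.2] with t ht
    rw [hΦ φ (fun x => u (x, t)) (fun x => G (x, t)), ht]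
  filter_upwards [hQ, ae_memLp_two_slice hu, ae_memLp_two_slice hG] with t ht hut hGt φ hφ hφc hφD
  have hclosed : IsClosed {q : Lp ℝ 2 (volume.restrict D) × Lp ℝ 2 (volume.restrict D) |
      (∫ x in D, u (x, t) * q.2 x) + ∫ x in D, G (x, t) * q.1 x = 0} := by
    have heq : ∀ q : Lp ℝ 2 (volume.restrict D) × Lp ℝ 2 (volume.restrict D),
        (∫ x in D, u (x, t) * q.2 x) + ∫ x in D, G (x, t) * q.1 x =
          inner ℝ (hut.toLp _) q.2 + inner ℝ (hGt.toLp _) q.1 := by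
      intro q
      rw [← inner_toLp_eq_integral_mul hut (Lp.memLp q.2),
        ← inner_toLp_eq_integral_mul hGt (Lp.memLp q.1), Lp.toLp_coeFn, Lp.toLp_coeFn]
    simp only [heq]
    exact isClosed_eq (by fun_prop) continuous_const
  have hmemφ := closure_minimal (t := {q | _}) ht hclosed (hQd (mem_range_self ⟨φ, hφ, hφc, hφD⟩))
  have hval : (∫ x in D, u (x, t) * (Φ ⟨φ, hφ, hφc, hφD⟩).2 x) +
      ∫ x in D, G (x, t) * (Φ ⟨φ, hφ, hφc, hφD⟩).1 x = 0 := hmemφ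
  rw [hΦ ⟨φ, hφ, hφc, hφD⟩ (fun x => u (x, t)) (fun x => G (x, t))] at hval
  exact eq_neg_of_add_eq_zero_left hval

end Slices

/-! ### Passage to the limit -/

lemma setIntegral_indicator_mul {α : Type*} [MeasurableSpace α] {μ : Measure α} {A B : Set α}
    (hA : MeasurableSet A) (hAB : A ⊆ B) (f k : α → ℝ) :
    ∫ z in B, A.indicator f z * k z ∂μ = ∫ z in A, f z * k z ∂μ := by
  have h : (fun z => A.indicator f z * k z) = A.indicator fun z => f z * k z :=
    funext fun z => (indicator_mul_left A f k).symm
  rw [h, setIntegral_indicator hA, inter_eq_right.2 hAB]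

section Limit

variable {N : ℕ} {Ω H : Set (EuclideanSpace ℝ (Fin N))} {T : ℝ}

/-- The cell average in the two-scale limit: the weight vanishes on the holes, so that the
characteristic function of `Y \ H` is not seen. -/
lemma integral_cell_channelWeight {a : ℝ} {j : Fin N}
    (ha : ∀ y ∈ H, Real.cos (2 * Real.pi * y j) < a) (b d : ℝ) :
    ∫ q in unitCell N ×ˢ Ioo (0 : ℝ) 1,
        b * (unitCell N \ H).indicator (fun _ => (1 : ℝ)) q.1 * (d * channelWeight a (q.1 j)) =
      b * d * ∫ q in unitCell N ×ˢ Ioo (0 : ℝ) 1, channelWeight a (q.1 j) := by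
  rw [← integral_const_mul]
  refine setIntegral_congr_fun ((isOpen_unitCell N).prod isOpen_Ioo).measurableSet fun q hq => ?_
  by_cases hqH : q.1 ∈ H
  · simp [channelWeight_eq_zero (ha _ hqH).le]
  · simp only [indicator_of_mem (show q.1 ∈ unitCell N \ H from ⟨hq.1, hqH⟩)]
    ring

/-- Under the hypotheses of the theorem, every partial derivative of the two-scale limit is
in `L²(Ω × (0,T))`, in the sense of an integration by parts on `Ω × S` for all measurable sets `S`
of times. -/
lemma exists_partial_deriv (hN : 2 ≤ N) (hΩ : IsOpen Ω) (hΩb : Bornology.IsBounded Ω)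
    (hH : IsCompact H) (hHY : H ⊆ unitCell N) {ε ε' : ℕ → ℝ} (hε : ∀ n, 0 < ε n)
    {uε : ℕ → EuclideanSpace ℝ (Fin N) × ℝ → ℝ}
    (hbdd : BoundedInL2H1 (fun n => perforatedDomain Ω H (ε n)) T uε)
    {u : EuclideanSpace ℝ (Fin N) × ℝ → ℝ}
    (hconv : TwoTwoScaleConverges Ω T ε ε'
      (fun n => (perforatedDomain Ω H (ε n) ×ˢ Ioo 0 T).indicator (uε n))
      (fun p => u p.1 * (unitCell N \ H).indicator (fun _ => (1 : ℝ)) p.2.1)) (i : Fin N) :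
    ∃ G : EuclideanSpace ℝ (Fin N) × ℝ → ℝ, MemLp G 2 (volume.restrict (Ω ×ˢ Ioo 0 T)) ∧
      ∀ φ : EuclideanSpace ℝ (Fin N) → ℝ,
        ContDiff ℝ ∞ φ → HasCompactSupport φ → tsupport φ ⊆ Ω → ∀ S : Set ℝ, MeasurableSet S →
          ∫ z in Ω ×ˢ Ioo 0 T, u z * (fderiv ℝ φ z.1 (EuclideanSpace.single i (1 : ℝ)) *
              S.indicator 1 z.2) =
            - ∫ z in Ω ×ˢ Ioo 0 T, G z * (φ z.1 * S.indicator 1 z.2) := by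
  -- the channels are orthogonal to a second coordinate direction
  have : Nontrivial (Fin N) := Fin.nontrivial_iff_two_le.2 hN
  obtain ⟨j, hji⟩ := exists_ne i
  obtain ⟨a, ha1, ha⟩ := exists_cos_lt hH hHY j
  obtain ⟨C, hC, hgC⟩ := hbdd
  choose g hg hgle using hgC
  have hΩfin : volume Ω ≠ ⊤ := hΩb.measure_lt_top.ne
  have hsub : ∀ n, perforatedDomain Ω H (ε n) ⊆ Ω := fun n => sdiff_subset
  have hDfin : ∀ n, volume (perforatedDomain Ω H (ε n)) ≠ ⊤ := fun n =>
    ne_top_of_le_ne_top hΩfin (measure_mono (hsub n))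
  have hprodsub : ∀ n, perforatedDomain Ω H (ε n) ×ˢ Ioo 0 T ⊆ Ω ×ˢ Ioo 0 T := fun n =>
    prod_mono (hsub n) Subset.rfl
  have hDmeas : ∀ n, MeasurableSet (perforatedDomain Ω H (ε n) ×ˢ Ioo 0 T) := fun n =>
    (measurableSet_perforatedDomain hΩ hH (ε n)).prod measurableSet_Ioo
  have := isFiniteMeasure_restrict_prod_Ioo (T := T) hΩfin
  have hweight : ∀ n, Continuous fun z : EuclideanSpace ℝ (Fin N) × ℝ =>
      channelWeight a ((ε n)⁻¹ * z.1 j) := fun n =>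
    (contDiff_channelWeight a).continuous.comp (by fun_prop)
  -- the weighted partial derivatives, extended by zero, are bounded in `L²(Ω × (0,T))`
  let w : ℕ → EuclideanSpace ℝ (Fin N) × ℝ → ℝ := fun n =>
    (perforatedDomain Ω H (ε n) ×ˢ Ioo 0 T).indicator fun z =>
      g n z i * channelWeight a ((ε n)⁻¹ * z.1 j)
  have hrestr : ∀ n, (volume.restrict (Ω ×ˢ Ioo 0 T)).restrict
      (perforatedDomain Ω H (ε n) ×ˢ Ioo 0 T) =
        (volume : Measure (EuclideanSpace ℝ (Fin N) × ℝ)).restrict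
          (perforatedDomain Ω H (ε n) ×ˢ Ioo 0 T) := fun n =>
    Measure.restrict_restrict_of_subset (hprodsub n)
  have hw : ∀ n, MemLp (w n) 2 (volume.restrict (Ω ×ˢ Ioo 0 T)) := by
    intro n
    rw [memLp_indicator_iff_restrict (hDmeas n), hrestr]
    exact memLp_mul_bounded ((hg n).memLp_grad.eval_piLp i) (hweight n).aestronglyMeasurable
      fun z => abs_channelWeight_le a _
  have hwb : ∀ n, eLpNorm (w n) 2 (volume.restrict (Ω ×ˢ Ioo 0 T)) ≤ C + 1 := by
    intro n
    have h1 : eLpNorm (w n) 2 (volume.restrict (Ω ×ˢ Ioo 0 T)) ≤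
        eLpNorm (g n) 2 (volume.restrict (perforatedDomain Ω H (ε n) ×ˢ Ioo 0 T)) := by
      rw [eLpNorm_indicator_eq_eLpNorm_restrict (hDmeas n), hrestr]
      refine eLpNorm_mono fun z => ?_
      rw [norm_mul]
      calc ‖g n z i‖ * ‖channelWeight a ((ε n)⁻¹ * z.1 j)‖ ≤ ‖g n z‖ * 1 :=
            mul_le_mul (PiLp.norm_apply_le _ _) (abs_channelWeight_le a _) (norm_nonneg _)
              (norm_nonneg _)
        _ = ‖g n z‖ := mul_one _
    refine h1.trans ?_
    rcases le_total (eLpNorm (g n) 2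
        (volume.restrict (perforatedDomain Ω H (ε n) ×ˢ Ioo 0 T))) 1 with h2 | h2
    · exact h2.trans le_add_self
    · exact (le_self_pow h2 two_ne_zero).trans
        (((hg n).eLpNorm_grad_sq_le.trans (hgle n)).trans le_self_add)
  obtain ⟨l, hl, hltop, G, hG, hGlim⟩ := exists_weak_limit hw (by finiteness) hwb
  set c : ℝ := ∫ q in unitCell N ×ˢ Ioo (0 : ℝ) 1, channelWeight a (q.1 j)
  have hc : 0 < c := integral_channelWeight_pos ha1 j
  refine ⟨fun z => c⁻¹ * G z, hG.const_mul _, fun φ hφ hφc hφΩ S hS => ?_⟩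
  have hbounded : ∀ p : EuclideanSpace ℝ (Fin N) → ℝ, Continuous p → HasCompactSupport p →
      MemLp (fun z : EuclideanSpace ℝ (Fin N) × ℝ => p z.1 * S.indicator (1 : ℝ → ℝ) z.2) 2
        (volume.restrict (Ω ×ˢ Ioo 0 T)) := by
    intro p hp hpc
    obtain ⟨b, hb⟩ := hpc.exists_bound_of_continuous hp
    refine MemLp.of_bound ((hp.measurable.comp measurable_fst).mul
      ((measurable_one.indicator hS).comp measurable_snd)).aestronglyMeasurable b
      (Eventually.of_forall fun z => ?_)
    by_cases hz : z.2 ∈ S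
    · simpa [hz] using hb z.1
    · simpa [hz] using (norm_nonneg _).trans (hb z.1)
  -- the admissible test function of the two-scale convergence
  let v : EuclideanSpace ℝ (Fin N) × ℝ → periodicCont N := fun z =>
    (fderiv ℝ φ z.1 (EuclideanSpace.single i (1 : ℝ)) * S.indicator 1 z.2) • channelCont a j
  have hv_apply : ∀ z q, (v z : (EuclideanSpace ℝ (Fin N) × ℝ) →ᵇ ℝ) q =
      fderiv ℝ φ z.1 (EuclideanSpace.single i (1 : ℝ)) * S.indicator 1 z.2 *
        channelWeight a (q.1 j) := fun z q => rfl
  have hφ' := hbounded _ (continuous_fderiv_single hφ i) (hasCompactSupport_fderiv_single hφc i)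
  have hv : MemLp v 2 (volume.restrict (Ω ×ˢ Ioo 0 T)) :=
    memLp_smul_channelCont hφ' a j
  have hlim := (hconv.tendsto v hv).mono_left hltop
  have hlim' := (hGlim _ (hbounded φ hφ.continuous hφc)).neg
  have hparts : ∀ n, ∫ z in Ω ×ˢ Ioo 0 T,
      (perforatedDomain Ω H (ε n) ×ˢ Ioo 0 T).indicator (uε n) z *
        (v z : (EuclideanSpace ℝ (Fin N) × ℝ) →ᵇ ℝ) ((ε n)⁻¹ • z.1, z.2 / ε' n) =
      - ∫ z in Ω ×ˢ Ioo 0 T, w n z * (φ z.1 * S.indicator 1 z.2) := by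
    intro n
    rw [setIntegral_indicator_mul (hDmeas n) (hprodsub n),
      setIntegral_indicator_mul (hDmeas n) (hprodsub n)]
    have hφn : ContDiff ℝ ∞ fun x => φ x * channelWeight a ((ε n)⁻¹ * x j) :=
      hφ.mul (contDiff_channelWeight_comp a (ε n) j)
    have h := (hg n).integral_eq (hDfin n) hφn hφc.mul_right
      (tsupport_mul_channelWeight_subset hφΩ (hε n) ha) i hS
    simp only [fderiv_mul_channelWeight hφ a (ε n) hji] at h
    simp only [hv_apply, PiLp.smul_apply, smul_eq_mul]
    refine Eq.trans ?_ (h.trans (congrArg Neg.neg ?_))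
    all_goals
      refine integral_congr_ae (Eventually.of_forall fun z => ?_)
      ring
  have hkey := tendsto_nhds_unique (hlim.congr hparts) hlim'
  have hcell : ∀ z : EuclideanSpace ℝ (Fin N) × ℝ,
      ∫ q in unitCell N ×ˢ Ioo (0 : ℝ) 1,
        u z * (unitCell N \ H).indicator (fun _ => (1 : ℝ)) q.1 *
          (v z : (EuclideanSpace ℝ (Fin N) × ℝ) →ᵇ ℝ) q =
        u z * (fderiv ℝ φ z.1 (EuclideanSpace.single i (1 : ℝ)) * S.indicator 1 z.2) * c := by
    intro z
    simp only [hv_apply]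
    exact integral_cell_channelWeight ha _ _
  simp only [hcell] at hkey
  rw [integral_mul_const] at hkey
  simp only [mul_assoc c⁻¹]
  rw [integral_const_mul, ← mul_neg, ← hkey, mul_comm c⁻¹, mul_assoc, mul_inv_cancel₀ hc.ne',
    mul_one]

end Limit

end Perforated

theorem proposition1 (N : ℕ) (hN : 2 ≤ N)
    (Ω : Set (EuclideanSpace ℝ (Fin N))) (hΩ : IsOpen Ω) (hΩb : Bornology.IsBounded Ω)
    (H : Set (EuclideanSpace ℝ (Fin N))) (hH : IsCompact H) (hHY : H ⊆ Perforated.unitCell N)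
    (T : ℝ) (hT : 0 < T) (r : ℝ) (hr : 0 < r)
    (ε : ℕ → ℝ) (hε : ∀ n, 0 < ε n) (hε0 : Tendsto ε atTop (𝓝 0))
    (uε : ℕ → EuclideanSpace ℝ (Fin N) × ℝ → ℝ)
    (hbdd : Perforated.BoundedInL2H1 (fun n => Perforated.perforatedDomain Ω H (ε n)) T uε)
    (u : EuclideanSpace ℝ (Fin N) × ℝ → ℝ)
    (hu : MemLp u 2 (volume.restrict (Ω ×ˢ Ioo 0 T)))
    (hconv : Perforated.TwoTwoScaleConverges Ω T ε (fun n => ε n ^ r)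
      (fun n => (Perforated.perforatedDomain Ω H (ε n) ×ˢ Ioo 0 T).indicator (uε n))
      (fun p => u p.1 * (Perforated.unitCell N \ H).indicator (fun _ => (1 : ℝ)) p.2.1)) :
    Perforated.MemL2H1 Ω T u := by
  choose G hG hGparts using
    Perforated.exists_partial_deriv hN hΩ hΩb hH hHY hε hbdd hconv
  let g : EuclideanSpace ℝ (Fin N) × ℝ → EuclideanSpace ℝ (Fin N) := fun z =>
    WithLp.toLp 2 fun i => G i z
  have hg : MemLp g 2 (volume.restrict (Ω ×ˢ Ioo 0 T)) := MemLp.of_eval_piLp hG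
  refine ⟨g, hu.1, hg.1, ?_, ?_⟩
  · have hslice := ae_all_iff.2 fun i =>
      Perforated.ae_slice_integral_eq hΩb.measure_lt_top.ne hu (hG i) i (hGparts i)
    filter_upwards [hslice, Perforated.ae_memLp_two_slice hu, Perforated.ae_memLp_two_slice hg]
      with t ht hut hgt
    exact ⟨hut, hgt, fun φ hφ hφc hφΩ i => ht i φ hφ hφc hφΩ⟩
  · rw [← Perforated.lintegral_prod_eq_l2H1NormSq hu.1 hg.1,
      lintegral_add_left' (hu.1.enorm.pow_const 2), ← Perforated.eLpNorm_two_sq,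
      ← Perforated.eLpNorm_two_sq]
    exact ENNReal.add_lt_top.2 ⟨ENNReal.pow_lt_top hu.2, ENNReal.pow_lt_top hg.2⟩
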